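/- Let $(\Omega,\mathcal A,\mathbb P)$ be an atomless probability space, let $d\ge 0$ be an integer, let $H=L^2(\Omega,\mathbb R^d)$ with inner product $\langle X,Y\rangle=\mathbb E[X\cdot Y]$ and norm $\|\cdot\|$, and let $\nu$ be any Borel probability measure on $\mathbb R^d$ with $\int|x|^2\,\nu(dx)<\infty$. Define the Hilbertian lift $U:H\to\mathbb R$ of the squared Wasserstein distance $W_2^2(\cdot,\nu)$ by $$U(X)=\inf\{\mathbb E|X-Y|^2 : Y\in H \text{ has law } \nu\},$$ and, for $\delta\in(0,1)$, its Lasry–Lions sup-convolution by $$U_\delta(X)=\sup_{X'\in H}\Big\{U(X')-\frac1\delta\|X-X'\|^2\Big\}.$$ Then, for every $\delta\in(0,1)$, $U_\delta$ is Fréchet differentiable on all of $H$. Moreover, if $U$ is Fréchet differentiable at $X_0\in H$, then for every family $(X_\delta)_{\delta\in(0,1)}$ in $H$ with $\|X_\delta-X_0\|\to0$ as $\delta\to0^+$ (at any rate), $$\lim_{\delta\to0^+}\|\nabla U_\delta(X_\delta)-\nabla U(X_0)\|=0.$$ -/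

import Mathlib

open MeasureTheory Filter Topology Set

/-- A measure is atomless if every measurable set of positive measure has a measurable subset of
positive, strictly smaller measure. (On a standard Borel space this says that points are null; the
definition also covers completed spaces.) -/
def Atomless {Ω : Type*} [MeasurableSpace Ω] (P : Measure Ω) : Prop :=
  ∀ A : Set Ω, MeasurableSet A → 0 < P A → ∃ B : Set Ω, B ⊆ A ∧ MeasurableSet B ∧ 0 < P B ∧ P B < P A

/-- The Hilbert space `H = L²(Ω, ℝᵈ)`, with inner product `⟪X, Y⟫ = 𝔼[X · Y]`. -/
abbrev RandomVectors {Ω : Type*} [MeasurableSpace Ω] (P : Measure Ω) (d : ℕ) : Type _ :=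
  Lp (EuclideanSpace ℝ (Fin d)) 2 P

/-- The lift `U(X) = inf {𝔼|X - Y|² : Y ∼ ν}` of `μ ↦ W₂²(μ, ν)` to `H`. A random vector with a
law `ν` of finite second moment is automatically in `H`, so the infimum is taken over `Y ∈ H`. -/
noncomputable def wassersteinLift {Ω : Type*} [MeasurableSpace Ω] (P : Measure Ω) {d : ℕ}
    (ν : Measure (EuclideanSpace ℝ (Fin d))) (X : RandomVectors P d) : ℝ :=
  ⨅ Y : {Y : RandomVectors P d // P.map Y = ν}, ∫ ω, ‖X ω - Y.1 ω‖ ^ 2 ∂P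

/-- The sup-convolution `f_δ(x) = sup_y {f(y) - ‖x - y‖² / δ}`. -/
noncomputable def supConvolution {H : Type*} [NormedAddCommGroup H] (f : H → ℝ) (δ : ℝ) (x : H) :
    ℝ :=
  ⨆ y : H, (f y - ‖x - y‖ ^ 2 / δ)

/-- The cost `𝔼|X - Y|²` is the squared distance in `H`. -/
theorem integral_norm_sub_sq {Ω : Type*} [MeasurableSpace Ω] (P : Measure Ω) {d : ℕ}
    (X Y : RandomVectors P d) : ∫ ω, ‖X ω - Y ω‖ ^ 2 ∂P = ‖X - Y‖ ^ 2 := by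
  rw [← real_inner_self_eq_norm_sq (X - Y), L2.inner_def]
  refine integral_congr_ae ?_
  filter_upwards [Lp.coeFn_sub X Y] with ω h
  rw [h, real_inner_self_eq_norm_sq, Pi.sub_apply]

/-- For `0 < δ < 1` the supremum that defines `U_δ` is finite. -/
theorem bddAbove_supConvolution_wassersteinLift {Ω : Type*} [MeasurableSpace Ω] (P : Measure Ω)
    {d : ℕ} (ν : Measure (EuclideanSpace ℝ (Fin d))) {δ : ℝ} (hδ : 0 < δ) (hδ' : δ < 1)
    (X : RandomVectors P d) :
    BddAbove (range fun X' => wassersteinLift P ν X' - ‖X - X'‖ ^ 2 / δ) := by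
  by_cases hne : Nonempty {Y : RandomVectors P d // P.map Y = ν}
  · obtain ⟨Y⟩ := hne
    refine ⟨‖X - Y.1‖ ^ 2 / (1 - δ), ?_⟩
    rintro _ ⟨X', rfl⟩
    have h1 : wassersteinLift P ν X' ≤ ‖X' - Y.1‖ ^ 2 := by
      rw [← integral_norm_sub_sq]
      exact ciInf_le ⟨0, by rintro _ ⟨Z, rfl⟩; positivity⟩ Y
    have h2 : ‖X' - Y.1‖ ≤ ‖X - X'‖ + ‖X - Y.1‖ := by
      have := norm_sub_le_norm_sub_add_norm_sub X' X Y.1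
      rwa [norm_sub_rev X' X] at this
    have h3 : ‖X' - Y.1‖ ^ 2 ≤ (‖X - X'‖ + ‖X - Y.1‖) ^ 2 := by gcongr
    have h4 : (‖X - X'‖ + ‖X - Y.1‖) ^ 2 ≤ ‖X - Y.1‖ ^ 2 / (1 - δ) + ‖X - X'‖ ^ 2 / δ := by
      have h5 : 0 < 1 - δ := by linarith
      rw [div_add_div _ _ h5.ne' hδ.ne', le_div_iff₀ (by positivity)]
      nlinarith [sq_nonneg (δ * ‖X - Y.1‖ - (1 - δ) * ‖X - X'‖)]
    simp only
    linarith
  · rw [not_nonempty_iff] at hne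
    refine ⟨0, ?_⟩
    rintro _ ⟨X', rfl⟩
    simp only [wassersteinLift, Real.iInf_of_isEmpty]
    have : 0 ≤ ‖X - X'‖ ^ 2 / δ := by positivity
    linarith

/-! `U` is the squared distance in `H` to the set `S` of vectors with law `ν`, so `U - ‖·‖²` is an
infimum of affine functions, hence concave. For `δ < 1` the penalty beats this square: the supremum
defining `U_δ(x)` is attained at some `p`, and `(2/δ)(p - x)` is both the gradient of `U_δ` at `x`
and a supergradient of `U` at `p`, up to the error `‖y - p‖²`. Since `‖p - x‖ = O(δ)` locally
uniformly in `x`, the maximizers for `X_δ` tend to `X₀` at whatever rate `X_δ` does, and such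
supergradients converge to the gradient at a point of differentiability. -/

open scoped RealInnerProductSpace in
/-- A function with a two-sided quadratic error bound at `x` has a gradient there. -/
theorem hasGradientAt_of_abs_sub_le {H : Type*} [NormedAddCommGroup H] [InnerProductSpace ℝ H]
    [CompleteSpace H] {f : H → ℝ} {x g : H} {C : ℝ}
    (h : ∀ u, |f (x + u) - f x - ⟪g, u⟫| ≤ C * ‖u‖ ^ 2) : HasGradientAt f g x := by
  rw [hasGradientAt_iff_isLittleO_nhds_zero]
  have h1 : (fun u => f (x + u) - f x - ⟪g, u⟫) =O[𝓝 0] fun u : H => ‖u‖ ^ 2 :=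
    Asymptotics.IsBigO.of_bound C (Eventually.of_forall fun u => by
      rw [Real.norm_eq_abs, Real.norm_of_nonneg (by positivity)]
      exact h u)
  exact h1.trans_isLittleO (Asymptotics.isLittleO_norm_pow_id one_lt_two)

/-- A continuous strongly concave function that is bounded above has a maximizer, away from which
it decreases quadratically. -/
theorem StrongConcaveOn.exists_forall_add_le {E : Type*} [NormedAddCommGroup E] [NormedSpace ℝ E]
    [CompleteSpace E] {m : ℝ} (hm : 0 < m) {h : E → ℝ} (hh : StrongConcaveOn univ m h)
    (hc : Continuous h) (hb : BddAbove (range h)) :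
    ∃ p, ∀ y, h y + m / 2 * ‖y - p‖ ^ 2 ≤ h p := by
  have hex (n : ℕ) : ∃ y, iSup h - 1 / ((n : ℝ) + 1) < h y :=
    exists_lt_of_lt_ciSup (sub_lt_self _ (by positivity))
  choose y hy using hex
  have hcauchy : CauchySeq y := by
    -- Strong concavity at the midpoint gains `m/8 * ‖y n - y k‖²`, which near-maximality bounds by
    -- `1/(N+1)`.
    refine cauchySeq_of_le_tendsto_0 (fun N : ℕ => √(8 / m * (1 / ((N : ℝ) + 1)))) ?_ ?_
    · intro n k N hn hk
      rw [dist_eq_norm]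
      refine Real.le_sqrt_of_sq_le ?_
      have h1 := hh.2 (mem_univ (y n)) (mem_univ (y k)) one_half_pos.le one_half_pos.le
        (add_halves 1)
      have h2 := le_ciSup hb ((1 / 2 : ℝ) • y n + (1 / 2 : ℝ) • y k)
      have h3 : 1 / ((n : ℝ) + 1) ≤ 1 / ((N : ℝ) + 1) := by gcongr
      have h4 : 1 / ((k : ℝ) + 1) ≤ 1 / ((N : ℝ) + 1) := by gcongr
      have h5 := hy n
      have h6 := hy k
      simp only [smul_eq_mul] at h1
      rw [div_mul_eq_mul_div, le_div_iff₀ hm]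
      linarith
    · rw [← Real.sqrt_zero, ← mul_zero (8 / m)]
      exact (tendsto_one_div_add_atTop_nhds_zero_nat.const_mul _).sqrt
  obtain ⟨p, hp⟩ := cauchySeq_tendsto_of_complete hcauchy
  have hmax (z : E) : h z ≤ h p := by
    refine (le_ciSup hb z).trans ?_
    have h1 : Tendsto (fun n : ℕ => iSup h - 1 / ((n : ℝ) + 1)) atTop (𝓝 (iSup h)) := by
      simpa using tendsto_one_div_add_atTop_nhds_zero_nat.const_sub (iSup h)
    exact le_of_tendsto_of_tendsto' h1 ((hc.tendsto p).comp hp) fun n => (hy n).le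
  refine ⟨p, fun z => ?_⟩
  -- Strong concavity on the segment from `p` to `z`, divided by `t`; letting `t → 0` recovers the
  -- full constant `m/2`.
  have hlim : Tendsto (fun t : ℝ => h z + (1 - t) * (m / 2 * ‖z - p‖ ^ 2)) (𝓝[>] 0)
      (𝓝 (h z + m / 2 * ‖z - p‖ ^ 2)) := by
    have : Continuous fun t : ℝ => h z + (1 - t) * (m / 2 * ‖z - p‖ ^ 2) := by fun_prop
    simpa using (this.tendsto 0).mono_left nhdsWithin_le_nhds
  refine le_of_tendsto hlim ?_
  filter_upwards [Ioo_mem_nhdsGT (zero_lt_one' ℝ)] with t ht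
  have h1 := hh.2 (mem_univ z) (mem_univ p) ht.1.le (sub_nonneg.2 ht.2.le) (by ring)
  have h2 := hmax (t • z + (1 - t) • p)
  simp only [smul_eq_mul] at h1
  refine le_of_mul_le_mul_left ?_ ht.1
  linarith

/-! ### Squared distance to a set -/

section InfDist

variable {H : Type*} [NormedAddCommGroup H]

theorem infDist_sq_le_norm_sub_sq {S : Set H} {s : H} (hs : s ∈ S) (x : H) :
    Metric.infDist x S ^ 2 ≤ ‖x - s‖ ^ 2 := by
  rw [← dist_eq_norm]
  exact pow_le_pow_left₀ Metric.infDist_nonneg (Metric.infDist_le_dist_of_mem hs) 2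

theorem le_infDist_sq {S : Set H} (hS : S.Nonempty) {x : H} {c : ℝ}
    (h : ∀ s ∈ S, c ≤ ‖x - s‖ ^ 2) : c ≤ Metric.infDist x S ^ 2 := by
  refine Real.sqrt_le_left Metric.infDist_nonneg |>.1 ?_
  refine (Metric.le_infDist hS).2 fun s hs => ?_
  rw [dist_eq_norm]
  exact Real.sqrt_le_iff.2 ⟨norm_nonneg _, h s hs⟩

theorem continuous_infDist_sq (S : Set H) : Continuous fun x => Metric.infDist x S ^ 2 :=
  (Metric.continuous_infDist_pt S).pow 2

/-- The squared distance to any set is `‖x‖²` plus a concave function. -/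
theorem strongConcaveOn_infDist_sq [InnerProductSpace ℝ H] (S : Set H) :
    StrongConcaveOn univ (-2) fun x => Metric.infDist x S ^ 2 := by
  refine ⟨convex_univ, fun x _ y _ a b ha hb hab => ?_⟩
  simp only [smul_eq_mul]
  rcases S.eq_empty_or_nonempty with rfl | hS
  · simp only [Metric.infDist_empty]
    nlinarith [mul_nonneg (mul_nonneg ha hb) (sq_nonneg ‖x - y‖)]
  refine le_infDist_sq hS fun s hs => ?_
  have h1 := mul_le_mul_of_nonneg_left (infDist_sq_le_norm_sub_sq hs x) ha
  have h2 := mul_le_mul_of_nonneg_left (infDist_sq_le_norm_sub_sq hs y) hb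
  -- For a single point `s` the inequality is an equality, with a defect independent of `s`, so it
  -- passes to the infimum.
  have h3 : ‖a • x + b • y - s‖ ^ 2
      = a * ‖x - s‖ ^ 2 + b * ‖y - s‖ ^ 2 - a * b * ‖x - y‖ ^ 2 := by
    have e1 : a • x + b • y - s = a • (x - s) + b • (y - s) := by
      obtain rfl := eq_sub_of_add_eq hab
      module
    have e2 : x - y = (x - s) - (y - s) := by abel
    rw [e1, e2, norm_add_sq_real, norm_sub_sq_real (x - s), norm_smul, norm_smul,
      real_inner_smul_left, real_inner_smul_right, Real.norm_of_nonneg ha,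
      Real.norm_of_nonneg hb]
    obtain rfl := eq_sub_of_add_eq hab
    ring
  rw [h3]
  linarith

end InfDist

/-! ### Sup-convolution and supergradients -/

section SupConvolution

open scoped RealInnerProductSpace

variable {H : Type*} [NormedAddCommGroup H] [InnerProductSpace ℝ H]

theorem strongConcaveOn_sub_norm_sub_sq_div {f : H → ℝ} (hf : StrongConcaveOn univ (-2) f)
    (δ : ℝ) (x : H) :
    StrongConcaveOn univ (2 / δ - 2) fun y => f y - ‖x - y‖ ^ 2 / δ := by
  rw [strongConcaveOn_iff_convex] at hf ⊢
  have h1 := ((innerₛₗ ℝ ((2 / δ) • x)).concaveOn convex_univ).add_const (-(‖x‖ ^ 2 / δ))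
  refine (hf.add h1).congr fun y _ => ?_
  simp only [Pi.add_apply, innerₛₗ_apply_apply, real_inner_smul_left, norm_sub_sq_real]
  ring

/-- Testing the supergradient inequality at `y = x` and using that the distance is 1-Lipschitz gives
`‖p - x‖ / δ ≤ infDist x S + ‖p - x‖`. -/
theorem norm_sub_le_of_forall_infDist_sq_le {S : Set H} {δ : ℝ} (hδ : 0 < δ) (hδ' : δ < 1) {x p : H}
    (hp : ∀ y, Metric.infDist y S ^ 2 ≤
      Metric.infDist p S ^ 2 + ⟪(2 / δ) • (p - x), y - p⟫ + ‖y - p‖ ^ 2) :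
    ‖p - x‖ ≤ δ / (1 - δ) * Metric.infDist x S := by
  have h1 := hp x
  have h2 : Metric.infDist p S ≤ Metric.infDist x S + ‖p - x‖ := by
    rw [← dist_eq_norm]
    exact Metric.infDist_le_infDist_add_dist
  have h3 : Metric.infDist p S ^ 2 ≤ (Metric.infDist x S + ‖p - x‖) ^ 2 :=
    pow_le_pow_left₀ Metric.infDist_nonneg h2 2
  have h4 : ⟪(2 / δ) • (p - x), x - p⟫ = -(2 / δ * ‖p - x‖ ^ 2) := by
    rw [← neg_sub p x, inner_neg_right, real_inner_smul_left, real_inner_self_eq_norm_sq]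
  rw [h4, norm_sub_rev x p] at h1
  have h5 : 0 < 1 - δ := sub_pos.2 hδ'
  rcases (norm_nonneg (p - x)).eq_or_lt with h0 | h0
  · rw [← h0]
    exact mul_nonneg (by positivity) Metric.infDist_nonneg
  have h6 : 1 / δ * ‖p - x‖ ^ 2 ≤ (Metric.infDist x S + ‖p - x‖) * ‖p - x‖ := by
    have : 2 / δ = 2 * (1 / δ) := by ring
    rw [this] at h1
    linarith
  rw [sq, ← mul_assoc] at h6
  have h7 := le_of_mul_le_mul_right h6 h0
  rw [one_div_mul_eq_div, div_le_iff₀ hδ] at h7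
  rw [div_mul_eq_mul_div, le_div_iff₀ h5]
  linarith

variable [CompleteSpace H]

/-- The sup-convolution has a gradient at `x`, which is a supergradient of `f`, up to a square,
at the point where the supremum is attained. -/
theorem exists_hasGradientAt_supConvolution {f : H → ℝ} (hf : StrongConcaveOn univ (-2) f)
    (hc : Continuous f) {δ : ℝ} (hδ : 0 < δ) (hδ' : δ < 1)
    (hb : ∀ x, BddAbove (range fun y => f y - ‖x - y‖ ^ 2 / δ)) (x : H) :
    ∃ p, HasGradientAt (supConvolution f δ) ((2 / δ) • (p - x)) x ∧
      ∀ y, f y ≤ f p + ⟪(2 / δ) • (p - x), y - p⟫ + ‖y - p‖ ^ 2 := by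
  obtain ⟨a, rfl⟩ : ∃ a, δ = a⁻¹ := ⟨δ⁻¹, (inv_inv δ).symm⟩
  have ha : 1 < a := by simpa using (one_lt_inv₀ hδ).2 hδ'
  have ha1 : 0 < a - 1 := sub_pos.2 ha
  have hstrong := strongConcaveOn_sub_norm_sub_sq_div hf a⁻¹ x
  simp only [div_inv_eq_mul] at hb hstrong ⊢
  obtain ⟨p, hp⟩ := hstrong.exists_forall_add_le (by linarith) (by fun_prop) (hb x)
  have expand (y u : H) : ‖x + u - y‖ ^ 2 = ‖u‖ ^ 2 + ‖p - x‖ ^ 2 + ‖y - p‖ ^ 2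
      - 2 * ⟪p - x, u⟫ - 2 * ⟪u, y - p⟫ + 2 * ⟪p - x, y - p⟫ := by
    have : x + u - y = u - (p - x) - (y - p) := by abel
    rw [this, norm_sub_sq_real, norm_sub_sq_real, inner_sub_left, real_inner_comm u (p - x)]
    ring
  -- The decay `(a - 1)‖y - p‖²` at the maximizer reduces the error from `a‖y - p‖²` to `‖y - p‖²`,
  -- uniformly in `δ`.
  have hsuper (y : H) : f y ≤ f p + ⟪(2 * a) • (p - x), y - p⟫ + ‖y - p‖ ^ 2 := by
    have h1 := hp y
    have h2 := expand y 0
    simp only [add_zero, norm_zero, inner_zero_left, inner_zero_right] at h2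
    rw [h2, norm_sub_rev x p] at h1
    rw [real_inner_smul_left]
    linarith
  refine ⟨p, ?_, hsuper⟩
  have hval : supConvolution f a⁻¹ x = f p - ‖x - p‖ ^ 2 * a := by
    simp only [supConvolution, div_inv_eq_mul]
    refine le_antisymm (ciSup_le fun y => ?_) (le_ciSup (hb x) p)
    have : 0 ≤ (2 * a - 2) / 2 * ‖y - p‖ ^ 2 := mul_nonneg (by linarith) (sq_nonneg _)
    linarith [hp y]
  -- The lower bound uses the competitor `p` and costs `a‖u‖²`; in the upper bound, completing the
  -- square in `‖y - p‖` produces `a²/(a-1)`.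
  refine hasGradientAt_of_abs_sub_le (C := a ^ 2 / (a - 1) + a) fun u => ?_
  have hC : 0 ≤ a ^ 2 / (a - 1) := by positivity
  have hu := sq_nonneg ‖u‖
  rw [hval, norm_sub_rev x p, real_inner_smul_left, abs_le]
  constructor
  · have h1 : f p - ‖x + u - p‖ ^ 2 * a ≤ supConvolution f a⁻¹ (x + u) := by
      simp only [supConvolution, div_inv_eq_mul]
      exact le_ciSup (hb (x + u)) p
    rw [expand p u] at h1
    simp only [sub_self, norm_zero, inner_zero_right] at h1
    have h2 := mul_nonneg hC hu
    linarith
  · have h1 : supConvolution f a⁻¹ (x + u) ≤ f p - ‖p - x‖ ^ 2 * a + 2 * a * ⟪p - x, u⟫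
        + a ^ 2 / (a - 1) * ‖u‖ ^ 2 := by
      simp only [supConvolution, div_inv_eq_mul]
      refine ciSup_le fun y => ?_
      have h2 := hsuper y
      rw [real_inner_smul_left] at h2
      have h3 : 2 * a * ⟪u, y - p⟫ ≤ (a - 1) * ‖y - p‖ ^ 2 + a ^ 2 / (a - 1) * ‖u‖ ^ 2 := by
        have h4 : 2 * a * ⟪u, y - p⟫ ≤ 2 * a * (‖u‖ * ‖y - p‖) :=
          mul_le_mul_of_nonneg_left (real_inner_le_norm _ _) (by linarith)
        have h5 : 0 ≤ ((a - 1) * ‖y - p‖ - a * ‖u‖) ^ 2 / (a - 1) := by positivity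
        have h6 : ((a - 1) * ‖y - p‖ - a * ‖u‖) ^ 2 / (a - 1)
            = (a - 1) * ‖y - p‖ ^ 2 + a ^ 2 / (a - 1) * ‖u‖ ^ 2 - 2 * a * (‖u‖ * ‖y - p‖) := by
          field_simp
          ring
        linarith
      have h7 := mul_nonneg (by linarith : 0 ≤ a) hu
      rw [expand y u]
      linarith
    have h2 := mul_nonneg (by linarith : 0 ≤ a) hu
    linarith

/-- Supergradients (up to a square) at points converging to `x₀` converge to the gradient at `x₀`,
if `f` is Fréchet differentiable there. -/
theorem HasGradientAt.tendsto_of_forall_le {ι : Type*} {l : Filter ι} {f : H → ℝ} {x₀ g : H}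
    (hf : HasGradientAt f g x₀) {p q : ι → H} (hp : Tendsto p l (𝓝 x₀))
    (hq : ∀ᶠ i in l, ∀ y, f y ≤ f (p i) + ⟪q i, y - p i⟫ + ‖y - p i‖ ^ 2) :
    Tendsto q l (𝓝 g) := by
  rw [Metric.tendsto_nhds]
  intro ε' hε'
  -- The errors below add up to `‖q i - g‖ ≤ 8.5 ε`; 10 leaves room.
  obtain ⟨ε, hε, hεε'⟩ : ∃ ε : ℝ, 0 < ε ∧ 10 * ε = ε' := ⟨ε' / 10, by positivity, by ring⟩
  obtain ⟨ρ, hρ, hρf⟩ := Metric.eventually_nhds_iff.1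
    ((hasGradientAt_iff_isLittleO_nhds_zero.1 hf).def hε)
  obtain ⟨r, hr, hrρ, hrε⟩ : ∃ r : ℝ, 0 < r ∧ r < ρ ∧ r ≤ ε :=
    ⟨min (ρ / 2) ε, by positivity, (min_le_left _ _).trans_lt (by linarith), min_le_right _ _⟩
  have hs : Tendsto (fun i => ‖x₀ - p i‖) l (𝓝 0) := by
    simpa using (hp.const_sub x₀).norm
  have herr : Tendsto (fun i => f (p i) - f x₀ + ‖g‖ * ‖x₀ - p i‖) l (𝓝 0) := by
    have h1 := (hf.differentiableAt.continuousAt.tendsto.comp hp).sub_const (f x₀)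
    simpa using h1.add (hs.const_mul ‖g‖)
  filter_upwards [hq, hs.eventually_lt_const (half_pos hr),
    herr.eventually_lt_const (mul_pos hε hr)] with i hi hsi herri
  rw [dist_eq_norm, ← hεε']
  rcases eq_or_ne (q i - g) 0 with h0 | h0
  · rw [h0, norm_zero]
    positivity
  have hn : 0 < ‖q i - g‖ := norm_pos_iff.2 h0
  -- Stepping against `q i - g`, the supergradient bound falls below the first-order expansion by
  -- `r‖q i - g‖`, up to small errors.
  set v : H := -(r / ‖q i - g‖) • (q i - g) with hv
  have hvn : ‖v‖ = r := by
    rw [hv, norm_smul, norm_neg, Real.norm_of_nonneg (by positivity), div_mul_cancel₀ _ hn.ne']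
  have hvi : ⟪q i - g, v⟫ = -(r * ‖q i - g‖) := by
    rw [hv, real_inner_smul_right, real_inner_self_eq_norm_sq]
    field_simp
  have h1 := hρf (y := v) (by rwa [dist_zero_right, hvn])
  rw [Real.norm_eq_abs, hvn] at h1
  have h2 := (abs_le.1 h1).1
  have h3 := hi (x₀ + v)
  have h4 : x₀ + v - p i = v + (x₀ - p i) := by abel
  have h5 : ‖x₀ + v - p i‖ ^ 2 ≤ (r + ‖x₀ - p i‖) ^ 2 := by
    rw [h4, ← hvn]
    gcongr
    exact norm_add_le _ _
  have h6 : ⟪q i, x₀ + v - p i⟫ = ⟪q i - g, v⟫ + ⟪g, v⟫ + ⟪q i - g, x₀ - p i⟫ + ⟪g, x₀ - p i⟫ := by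
    rw [h4]
    simp only [inner_add_right, inner_sub_left]
    ring
  have h7 := real_inner_le_norm (q i - g) (x₀ - p i)
  have h8 := real_inner_le_norm g (x₀ - p i)
  have h9 : ‖q i - g‖ * ‖x₀ - p i‖ ≤ ‖q i - g‖ * (r / 2) := by gcongr
  have h10 : (r + ‖x₀ - p i‖) ^ 2 ≤ (r + r / 2) ^ 2 := by gcongr
  have h11 : r * r ≤ r * ε := by gcongr
  have h12 : r * ‖q i - g‖ < r * (10 * ε) := by nlinarith [mul_pos hr hε]
  exact lt_of_mul_lt_mul_left h12 hr.le

end SupConvolution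

/-- The lift `U` is the squared distance in `H` to the set of random vectors with law `ν`. -/
theorem wassersteinLift_eq_infDist_sq {Ω : Type*} [MeasurableSpace Ω] (P : Measure Ω) {d : ℕ}
    (ν : Measure (EuclideanSpace ℝ (Fin d))) :
    wassersteinLift P ν =
      fun X => Metric.infDist X {Y : RandomVectors P d | P.map Y = ν} ^ 2 := by
  funext X
  simp only [wassersteinLift, integral_norm_sub_sq]
  rcases isEmpty_or_nonempty {Y : RandomVectors P d // P.map Y = ν} with h | h
  · have : {Y : RandomVectors P d | P.map Y = ν} = ∅ := isEmpty_coe_sort.1 h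
    rw [this, Metric.infDist_empty, Real.iInf_of_isEmpty]
    norm_num
  · refine le_antisymm (le_infDist_sq (nonempty_coe_sort.1 h) fun Y hY => ?_)
      (le_ciInf fun Y => infDist_sq_le_norm_sub_sq (S := {Y : RandomVectors P d | P.map Y = ν}) Y.2 X)
    exact ciInf_le ⟨0, by rintro _ ⟨Z, rfl⟩; positivity⟩
      (⟨Y, hY⟩ : {Y : RandomVectors P d // P.map Y = ν})

/-- `gradient` is the Fréchet gradient in the Hilbert space `H = L²(Ω, ℝᵈ)`. -/
theorem mainTheorem1 {Ω : Type*} [MeasurableSpace Ω] (P : Measure Ω) [IsProbabilityMeasure P]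
    (hP : Atomless P) (d : ℕ) (ν : Measure (EuclideanSpace ℝ (Fin d))) [IsProbabilityMeasure ν]
    (hν : Integrable (fun x => ‖x‖ ^ 2) ν) :
    (∀ δ ∈ Ioo (0 : ℝ) 1, Differentiable ℝ (supConvolution (wassersteinLift P ν) δ)) ∧
    ∀ X₀ : RandomVectors P d, DifferentiableAt ℝ (wassersteinLift P ν) X₀ →
      ∀ X : ℝ → RandomVectors P d, Tendsto X (𝓝[>] 0) (𝓝 X₀) →
        Tendsto (fun δ => gradient (supConvolution (wassersteinLift P ν) δ) (X δ)) (𝓝[>] 0)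
          (𝓝 (gradient (wassersteinLift P ν) X₀)) := by
  have hb (δ : ℝ) (hδ : δ ∈ Ioo (0 : ℝ) 1) :=
    bddAbove_supConvolution_wassersteinLift P ν hδ.1 hδ.2
  rw [wassersteinLift_eq_infDist_sq] at *
  set S := {Y : RandomVectors P d | P.map Y = ν}
  have key (δ : ℝ) (hδ : δ ∈ Ioo (0 : ℝ) 1) (x : RandomVectors P d) :=
    exists_hasGradientAt_supConvolution (strongConcaveOn_infDist_sq S) (continuous_infDist_sq S)
      hδ.1 hδ.2 (hb δ hδ) x
  refine ⟨fun δ hδ x => (key δ hδ x).choose_spec.1.differentiableAt, fun X₀ hX₀ X hX => ?_⟩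
  -- Outside `(0, 1)` the maximizer is replaced by the dummy value 0, which the limit does not see.
  have hex (δ : ℝ) : ∃ p, ∀ hδ : δ ∈ Ioo (0 : ℝ) 1, p = (key δ hδ (X δ)).choose := by
    by_cases hδ : δ ∈ Ioo (0 : ℝ) 1
    · exact ⟨(key δ hδ (X δ)).choose, fun _ => rfl⟩
    · exact ⟨0, fun h => absurd h hδ⟩
  choose p hp using hex
  have hsmall : ∀ᶠ δ : ℝ in 𝓝[>] 0, δ ∈ Ioo (0 : ℝ) 1 := Ioo_mem_nhdsGT zero_lt_one
  have hgap : Tendsto (fun δ => p δ - X δ) (𝓝[>] 0) (𝓝 0) := by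
    have h1 : Tendsto (fun δ : ℝ => δ / (1 - δ) * Metric.infDist (X δ) S) (𝓝[>] 0) (𝓝 0) := by
      have h2 : Tendsto (fun δ : ℝ => δ / (1 - δ)) (𝓝[>] 0) (𝓝 0) := by
        have : ContinuousAt (fun δ : ℝ => δ / (1 - δ)) 0 :=
          continuousAt_id.div (by fun_prop) (by norm_num)
        simpa using this.tendsto.mono_left nhdsWithin_le_nhds
      simpa using h2.mul (((Metric.continuous_infDist_pt S).tendsto X₀).comp hX)
    refine squeeze_zero_norm' ?_ h1
    filter_upwards [hsmall] with δ hδ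
    rw [hp δ hδ]
    exact norm_sub_le_of_forall_infDist_sq_le hδ.1 hδ.2 (key δ hδ (X δ)).choose_spec.2
  have hpX : Tendsto p (𝓝[>] 0) (𝓝 X₀) := by simpa using hgap.add hX
  refine hX₀.hasGradientAt.tendsto_of_forall_le hpX ?_
  filter_upwards [hsmall] with δ hδ
  rw [(key δ hδ (X δ)).choose_spec.1.gradient]
  have h := (key δ hδ (X δ)).choose_spec.2
  rwa [← hp δ hδ] at h ⊢
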